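/- Let $R$ be an associative (not necessarily commutative) ring with identity, let $n\geq 1$, and let $M=(M_i)_{i=1}^n$ be a family of $R$-bimodules together with, for all $i,j\geq 1$ with $i+j\leq n$, a biadditive map $M_i\times M_j\to M_{i+j}$, $(x,y)\mapsto xy$, such that $(rx)y=r(xy)$, $(xr)y=x(ry)$, $x(yr)=(xy)r$ for $r\in R$, and $(xy)z=x(yz)$ for $x\in M_i$, $y\in M_j$, $z\in M_l$ with $i+j+l\leq n$. Let $R\ltimes_n M$ be the $n$-trivial extension ring, that is, the additive group $R\oplus M_1\oplus\cdots\oplus M_n$ with the multiplication $$(m_0,\dots,m_n)(m'_0,\dots,m'_n)=\Big(\sum_{i+j=k}m_i m'_j\Big)_{0\leq k\leq n},$$ where $m_0,m'_0\in R$, and products with $m_0$ or $m'_0$ are given by the ring and bimodule structures. For $k\in\mathbb N=\{0,1,2,\dots\}$, a ring is called $k$-perfect if every flat left module over it has projective dimension at most $k$. Then, for every $k\in\mathbb N$, $R\ltimes_n M$ is $k$-perfect if and only if $R$ is $k$-perfect. -/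

import Mathlib

open scoped TensorProduct RightActions

universe u

/-! ### Tensor products and flat modules over a not necessarily commutative ring -/

section Flat

variable (R : Type u) [Ring R]

/-- The subgroup of `N ⊗[ℤ] X` generated by the elements `(n • r) ⊗ x - n ⊗ (r • x)`, for a right
`R`-module `N` and a left `R`-module `X`. -/
def balancedRelations (N X : Type u) [AddCommGroup N] [Module Rᵐᵒᵖ N]
    [AddCommGroup X] [Module R X] : AddSubgroup (N ⊗[ℤ] X) :=
  AddSubgroup.closure {t | ∃ (n : N) (r : R) (x : X), t = (n <• r) ⊗ₜ[ℤ] x - n ⊗ₜ[ℤ] (r • x)}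

/-- The tensor product `N ⊗_R X` (an abelian group) of a right `R`-module `N` and a left
`R`-module `X`. -/
abbrev BalancedTensor (N X : Type u) [AddCommGroup N] [Module Rᵐᵒᵖ N]
    [AddCommGroup X] [Module R X] : Type u :=
  (N ⊗[ℤ] X) ⧸ balancedRelations R N X

/-- The map `f ⊗ id : N ⊗_R X → P ⊗_R X` induced by a homomorphism `f` of right `R`-modules. -/
def BalancedTensor.map {N P : Type u} (X : Type u) [AddCommGroup N] [Module Rᵐᵒᵖ N]
    [AddCommGroup P] [Module Rᵐᵒᵖ P] [AddCommGroup X] [Module R X] (f : N →ₗ[Rᵐᵒᵖ] P) :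
    BalancedTensor R N X →+ BalancedTensor R P X :=
  QuotientAddGroup.map _ _
    (LinearMap.rTensor X f.toAddMonoidHom.toIntLinearMap).toAddMonoidHom <| by
      rw [balancedRelations, AddSubgroup.closure_le]
      rintro _ ⟨n, r, x, rfl⟩
      refine AddSubgroup.subset_closure ⟨f n, r, x, ?_⟩
      rw [map_sub, ← map_smul]
      rfl

/-- A left `R`-module `X` is flat if `- ⊗_R X` preserves injectivity of homomorphisms of right
`R`-modules. -/
def IsFlatModule (X : Type u) [AddCommGroup X] [Module R X] : Prop :=
  ∀ (N P : Type u) [AddCommGroup N] [Module Rᵐᵒᵖ N] [AddCommGroup P] [Module Rᵐᵒᵖ P]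
    (f : N →ₗ[Rᵐᵒᵖ] P), Function.Injective f → Function.Injective (BalancedTensor.map R X f)

/-- A ring `R` is `k`-perfect if every flat left `R`-module has projective dimension at most
`k`. -/
def IsKPerfect (k : ℕ) : Prop :=
  ∀ (X : Type u) [AddCommGroup X] [Module R X], IsFlatModule R X →
    CategoryTheory.projectiveDimension (ModuleCat.of R X) ≤ k

end Flat

/-! ### The `n`-trivial extension of a ring by a family of bimodules -/

section NTrivialExtension

/-- A family of products `M i × M j → M (i + j)`, for `i, j ≥ 1` and `i + j ≤ n`, on a family
`M 1, …, M n` of `R`-bimodules: biadditive, `R`-linear on the left and on the right, `R`-balanced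
in the middle, and associative. The index `k` with a proof of `i + j = k` stands for `i + j`. -/
structure PreProduct (n : ℕ) (R : Type u) [Ring R] (M : Finset.Icc 1 n → Type u)
    [∀ i, AddCommGroup (M i)] [∀ i, Module R (M i)] [∀ i, Module Rᵐᵒᵖ (M i)]
    [∀ i, SMulCommClass R Rᵐᵒᵖ (M i)] where
  mul : ∀ {i j k : Finset.Icc 1 n}, (i : ℕ) + j = k → M i →+ M j →+ M k
  smul_mul : ∀ {i j k : Finset.Icc 1 n} (h : (i : ℕ) + j = k) (r : R) (x : M i) (y : M j),
    mul h (r • x) y = r • mul h x y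
  mul_smul : ∀ {i j k : Finset.Icc 1 n} (h : (i : ℕ) + j = k) (r : R) (x : M i) (y : M j),
    mul h x (y <• r) = mul h x y <• r
  balanced : ∀ {i j k : Finset.Icc 1 n} (h : (i : ℕ) + j = k) (r : R) (x : M i) (y : M j),
    mul h (x <• r) y = mul h x (r • y)
  mul_assoc : ∀ {a b c ab bc abc : Finset.Icc 1 n} (h₁ : (a : ℕ) + b = ab)
    (h₂ : (ab : ℕ) + c = abc) (h₃ : (b : ℕ) + c = bc) (h₄ : (a : ℕ) + bc = abc)
    (x : M a) (y : M b) (z : M c),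
    mul h₂ (mul h₁ x y) z = mul h₄ x (mul h₃ y z)

variable {n : ℕ} {R : Type u} [Ring R] {M : Finset.Icc 1 n → Type u}
  [∀ i, AddCommGroup (M i)] [∀ i, Module R (M i)] [∀ i, Module Rᵐᵒᵖ (M i)]
  [∀ i, SMulCommClass R Rᵐᵒᵖ (M i)]

/-- The `n`-trivial extension `R ⋉ₙ M`: the additive group `R ⊕ M 1 ⊕ ⋯ ⊕ M n`, with the
multiplication defined below. -/
def NTrivialExt (_Φ : PreProduct n R M) : Type u := R × (∀ i, M i)

namespace NTrivialExt

variable {Φ : PreProduct n R M}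

instance : AddCommGroup (NTrivialExt Φ) := inferInstanceAs (AddCommGroup (R × (∀ i, M i)))

/-- The component in `R`. -/
def base (s : NTrivialExt Φ) : R := Prod.fst s

/-- The component in `M i`. -/
def comp (s : NTrivialExt Φ) (i : Finset.Icc 1 n) : M i := Prod.snd s i

/-- The element with given components. -/
def mk (r : R) (m : ∀ i, M i) : NTrivialExt Φ := (r, m)

/-- The unit is `(1, 0, …, 0)`. -/
instance : One (NTrivialExt Φ) := ⟨mk 1 0⟩

/-- The component of degree `k` of `s * t` is the sum of all products `sᵢ tⱼ` with `i + j = k`,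
where the component of degree `0` is the one in `R`. -/
instance : Mul (NTrivialExt Φ) :=
  ⟨fun s t => mk (s.base * t.base) fun k =>
    s.base • t.comp k + s.comp k <• t.base +
      ∑ i : Finset.Icc 1 n, ∑ j : Finset.Icc 1 n,
        if h : (i : ℕ) + j = k then Φ.mul h (s.comp i) (t.comp j) else 0⟩

@[ext] theorem ext {s t : NTrivialExt Φ} (h₀ : s.base = t.base) (h : ∀ i, s.comp i = t.comp i) :
    s = t :=
  Prod.ext h₀ (funext h)

@[simp] theorem base_mk (r : R) (m : ∀ i, M i) : (mk r m : NTrivialExt Φ).base = r := rfl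
@[simp] theorem comp_mk (r : R) (m : ∀ i, M i) : (mk r m : NTrivialExt Φ).comp = m := rfl
@[simp] theorem base_zero : (0 : NTrivialExt Φ).base = 0 := rfl
@[simp] theorem comp_zero (i) : (0 : NTrivialExt Φ).comp i = 0 := rfl
@[simp] theorem base_one : (1 : NTrivialExt Φ).base = 1 := rfl
@[simp] theorem comp_one (i) : (1 : NTrivialExt Φ).comp i = 0 := rfl
@[simp] theorem base_add (s t : NTrivialExt Φ) : (s + t).base = s.base + t.base := rfl
@[simp] theorem comp_add (s t : NTrivialExt Φ) (i) : (s + t).comp i = s.comp i + t.comp i := rfl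
@[simp] theorem base_mul (s t : NTrivialExt Φ) : (s * t).base = s.base * t.base := rfl

/-- The product `M i × M j → M k`, extended by zero to the case `i + j ≠ k`. -/
def mulAt (Φ : PreProduct n R M) (i j k : Finset.Icc 1 n) : M i →+ M j →+ M k :=
  if h : (i : ℕ) + j = k then Φ.mul h else 0

theorem comp_mul (s t : NTrivialExt Φ) (k : Finset.Icc 1 n) :
    (s * t).comp k = s.base • t.comp k + s.comp k <• t.base +
      ∑ i, ∑ j, mulAt Φ i j k (s.comp i) (t.comp j) := by
  change s.base • t.comp k + s.comp k <• t.base + _ = _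
  congr 1
  refine Finset.sum_congr rfl fun i _ => Finset.sum_congr rfl fun j _ => ?_
  unfold mulAt
  split_ifs <;> rfl

theorem smul_mulAt (i j k : Finset.Icc 1 n) (r : R) (x : M i) (y : M j) :
    mulAt Φ i j k (r • x) y = r • mulAt Φ i j k x y := by
  unfold mulAt; split_ifs with h
  · exact Φ.smul_mul h r x y
  · simp

theorem mulAt_smul (i j k : Finset.Icc 1 n) (r : R) (x : M i) (y : M j) :
    mulAt Φ i j k x (y <• r) = mulAt Φ i j k x y <• r := by
  unfold mulAt; split_ifs with h
  · exact Φ.mul_smul h r x y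
  · simp

theorem mulAt_balanced (i j k : Finset.Icc 1 n) (r : R) (x : M i) (y : M j) :
    mulAt Φ i j k (x <• r) y = mulAt Φ i j k x (r • y) := by
  unfold mulAt; split_ifs with h
  · exact Φ.balanced h r x y
  · simp

theorem mulAt_assoc (a b c k : Finset.Icc 1 n) (x : M a) (y : M b) (z : M c) :
    ∑ i, mulAt Φ i c k (mulAt Φ a b i x y) z = ∑ i, mulAt Φ a i k x (mulAt Φ b c i y z) := by
  by_cases h : (a : ℕ) + b + c = k
  · have hk := Finset.mem_Icc.1 k.2
    have ha := Finset.mem_Icc.1 a.2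
    have hb := Finset.mem_Icc.1 b.2
    let ab : Finset.Icc 1 n := ⟨a + b, Finset.mem_Icc.2 ⟨by omega, by omega⟩⟩
    let bc : Finset.Icc 1 n := ⟨b + c, Finset.mem_Icc.2 ⟨by omega, by omega⟩⟩
    rw [Finset.sum_eq_single ab, Finset.sum_eq_single bc]
    · have h₁ : (a : ℕ) + b = ab := rfl
      have h₂ : (ab : ℕ) + c = k := h
      have h₃ : (b : ℕ) + c = bc := rfl
      have h₄ : (a : ℕ) + bc = k := by rw [← h, ← h₃]; ring
      simp only [mulAt, dif_pos h₁, dif_pos h₂, dif_pos h₃, dif_pos h₄]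
      exact Φ.mul_assoc h₁ h₂ h₃ h₄ x y z
    · intro i _ hi
      have : ¬ (b : ℕ) + c = i := fun e => hi (Subtype.ext e.symm)
      simp [mulAt, dif_neg this]
    · simp
    · intro i _ hi
      have : ¬ (a : ℕ) + b = i := fun e => hi (Subtype.ext e.symm)
      simp [mulAt, dif_neg this]
    · simp
  · rw [Finset.sum_eq_zero, Finset.sum_eq_zero]
    · intro i _
      by_cases h₁ : (b : ℕ) + c = i
      · have h₂ : ¬ (a : ℕ) + i = k := by omega
        simp [mulAt, dif_neg h₂]
      · simp [mulAt, dif_neg h₁]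
    · intro i _
      by_cases h₁ : (a : ℕ) + b = i
      · have h₂ : ¬ (i : ℕ) + c = k := by omega
        simp [mulAt, dif_neg h₂]
      · simp [mulAt, dif_neg h₁]

theorem sum_mulAt_assoc (k : Finset.Icc 1 n) (s t w : ∀ i, M i) :
    ∑ i, ∑ c, mulAt Φ i c k (∑ a, ∑ b, mulAt Φ a b i (s a) (t b)) (w c) =
      ∑ a, ∑ i, mulAt Φ a i k (s a) (∑ b, ∑ c, mulAt Φ b c i (t b) (w c)) := by
  have hl : ∑ i, ∑ c, mulAt Φ i c k (∑ a, ∑ b, mulAt Φ a b i (s a) (t b)) (w c) =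
      ∑ a, ∑ b, ∑ c, ∑ i, mulAt Φ i c k (mulAt Φ a b i (s a) (t b)) (w c) := by
    simp only [map_sum, AddMonoidHom.finsetSum_apply]
    rw [Finset.sum_congr rfl fun i _ => Finset.sum_comm, Finset.sum_comm]
    refine Finset.sum_congr rfl fun a _ => ?_
    rw [Finset.sum_congr rfl fun i _ => Finset.sum_comm, Finset.sum_comm]
    exact Finset.sum_congr rfl fun b _ => Finset.sum_comm
  have hr : ∑ a, ∑ i, mulAt Φ a i k (s a) (∑ b, ∑ c, mulAt Φ b c i (t b) (w c)) =
      ∑ a, ∑ b, ∑ c, ∑ i, mulAt Φ a i k (s a) (mulAt Φ b c i (t b) (w c)) := by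
    simp only [map_sum]
    refine Finset.sum_congr rfl fun a _ => ?_
    rw [Finset.sum_comm]
    exact Finset.sum_congr rfl fun b _ => Finset.sum_comm
  rw [hl, hr]
  exact Finset.sum_congr rfl fun a _ => Finset.sum_congr rfl fun b _ =>
    Finset.sum_congr rfl fun c _ => mulAt_assoc a b c k _ _ _

protected theorem mul_assoc (s t w : NTrivialExt Φ) : s * t * w = s * (t * w) := by
  ext k
  · simp [mul_assoc]
  · have key := sum_mulAt_assoc (Φ := Φ) k s.comp t.comp w.comp
    simp only [comp_mul, base_mul, map_add, AddMonoidHom.add_apply, Finset.sum_add_distrib,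
      key, smul_mulAt, mulAt_smul, mulAt_balanced, smul_add, Finset.smul_sum, mul_smul,
      MulOpposite.op_mul, smul_comm s.base (MulOpposite.op w.base)]
    abel

instance : Ring (NTrivialExt Φ) where
  __ := (inferInstance : AddCommGroup (NTrivialExt Φ))
  __ := (inferInstance : Mul (NTrivialExt Φ))
  __ := (inferInstance : One (NTrivialExt Φ))
  mul_assoc := NTrivialExt.mul_assoc
  one_mul s := by ext k <;> simp [comp_mul]
  mul_one s := by ext k <;> simp [comp_mul]
  zero_mul s := by ext k <;> simp [comp_mul]
  mul_zero s := by ext k <;> simp [comp_mul]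
  left_distrib s t w := by
    ext k
    · simp [mul_add]
    · simp only [comp_mul, comp_add, base_add, smul_add, add_smul, MulOpposite.op_add, map_add,
        Finset.sum_add_distrib]
      abel
  right_distrib s t w := by
    ext k
    · simp [add_mul]
    · simp only [comp_mul, comp_add, base_add, smul_add, add_smul, map_add,
        AddMonoidHom.add_apply, Finset.sum_add_distrib]
      abel

end NTrivialExt

end NTrivialExtension

/-! Write S for the trivial extension, π : S → R for the projection and σ : R → S for the inclusion.
Then π ∘ σ = id, and I = ker π satisfies I^(n+1) = 0 because I lives in degrees ≥ 1. Only these two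
facts about S matter. The core is that a flat S-module X has the same projective dimension over S as
R ⊗_S X has over R (`IsFlatModule.hasProjectiveDimensionLE_baseChange_iff`). Dimension shifting
along 0 → K → F → X → 0, with F free, reduces this to dimension 0: K is again flat, and flatness of
X keeps the sequence exact after R ⊗_S -. In dimension 0, suppose K is flat and R ⊗_S K is
projective. An R-linear splitting of K → R ⊗_S K induces g : S ⊗_R (R ⊗_S K) → K, which becomes an
isomorphism after R ⊗_S -. Nakayama for the nilpotent ideal I kills the cokernel of g, then its
kernel, so K is projective (`IsFlatModule.projective_of_baseChange`). The theorem follows since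
extension of scalars along π and along σ preserves flatness, and R ⊗_S (S ⊗_R Y) ≅ Y for every
R-module Y. -/

/-! ### Balanced tensor products: functoriality, right exactness, free modules. -/

namespace BalancedTensor

variable {R : Type u} [Ring R] {N P Q X Y Z : Type u}
  [AddCommGroup N] [Module Rᵐᵒᵖ N] [AddCommGroup P] [Module Rᵐᵒᵖ P]
  [AddCommGroup Q] [Module Rᵐᵒᵖ Q] [AddCommGroup X] [Module R X]
  [AddCommGroup Y] [Module R Y] [AddCommGroup Z] [Module R Z]

variable (R) in
/-- The elementary tensor `n ⊗ x` in `N ⊗_R X`. -/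
def tmul (n : N) (x : X) : BalancedTensor R N X :=
  QuotientAddGroup.mk (n ⊗ₜ[ℤ] x)

theorem tmul_add (n : N) (x y : X) : tmul R n (x + y) = tmul R n x + tmul R n y :=
  congrArg QuotientAddGroup.mk (TensorProduct.tmul_add n x y)

theorem add_tmul (m n : N) (x : X) : tmul R (m + n) x = tmul R m x + tmul R n x :=
  congrArg QuotientAddGroup.mk (TensorProduct.add_tmul m n x)

theorem smul_tmul (n : N) (r : R) (x : X) : tmul R (n <• r) x = tmul R n (r • x) :=
  QuotientAddGroup.eq_iff_sub_mem.2 <| AddSubgroup.subset_closure ⟨n, r, x, rfl⟩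

@[simp] theorem tmul_zero (n : N) : tmul R n (0 : X) = 0 :=
  congrArg QuotientAddGroup.mk (TensorProduct.tmul_zero X n)

@[simp] theorem zero_tmul (x : X) : tmul R (0 : N) x = 0 :=
  congrArg QuotientAddGroup.mk (TensorProduct.zero_tmul N x)

@[elab_as_elim]
theorem induction_on {p : BalancedTensor R N X → Prop} (t : BalancedTensor R N X)
    (zero : p 0) (tmul : ∀ n x, p (tmul R n x)) (add : ∀ s t, p s → p t → p (s + t)) : p t := by
  obtain ⟨t, rfl⟩ := QuotientAddGroup.mk_surjective t
  induction t using TensorProduct.induction_on with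
  | zero => exact zero
  | tmul n x => exact tmul n x
  | add s t hs ht => exact add _ _ hs ht

/-- The homomorphism on `N ⊗_R X` given by a balanced biadditive map on `N × X`. -/
def lift {G : Type*} [AddCommGroup G] (f : N →+ X →+ G)
    (hf : ∀ n (r : R) x, f (n <• r) x = f n (r • x)) : BalancedTensor R N X →+ G :=
  QuotientAddGroup.lift _ (TensorProduct.liftAddHom f fun r n x => by simp) <| by
    rw [balancedRelations, AddSubgroup.closure_le]
    rintro _ ⟨n, r, x, rfl⟩
    simp [hf]

@[simp] theorem lift_tmul {G : Type*} [AddCommGroup G] (f : N →+ X →+ G)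
    (hf : ∀ n (r : R) x, f (n <• r) x = f n (r • x)) (n : N) (x : X) :
    lift f hf (tmul R n x) = f n x := rfl

@[simp] theorem map_tmul (f : N →ₗ[Rᵐᵒᵖ] P) (n : N) (x : X) :
    map R X f (tmul R n x) = tmul R (f n) x := rfl

variable (N) in
/-- The map `id ⊗ g : N ⊗_R X → N ⊗_R Y` induced by a homomorphism `g` of left `R`-modules. -/
def mapRight (g : X →ₗ[R] Y) : BalancedTensor R N X →+ BalancedTensor R N Y :=
  QuotientAddGroup.map _ _
    (LinearMap.lTensor N g.toAddMonoidHom.toIntLinearMap).toAddMonoidHom <| by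
      rw [balancedRelations, AddSubgroup.closure_le]
      rintro _ ⟨n, r, x, rfl⟩
      refine AddSubgroup.subset_closure ⟨n, r, g x, ?_⟩
      rw [map_sub, ← map_smul]
      rfl

@[simp] theorem mapRight_tmul (g : X →ₗ[R] Y) (n : N) (x : X) :
    mapRight N g (tmul R n x) = tmul R n (g x) := rfl

theorem hom_ext {G : Type*} [AddCommGroup G] {f g : BalancedTensor R N X →+ G}
    (h : ∀ n x, f (tmul R n x) = g (tmul R n x)) : f = g := by
  refine DFunLike.ext _ _ fun t => ?_
  induction t using induction_on with
  | zero => simp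
  | tmul n x => exact h n x
  | add s t hs ht => rw [map_add, map_add, hs, ht]

theorem map_mapRight (f : N →ₗ[Rᵐᵒᵖ] P) (g : X →ₗ[R] Y) (t : BalancedTensor R N X) :
    map R Y f (mapRight N g t) = mapRight P g (map R X f t) :=
  DFunLike.congr_fun (f := (map R Y f).comp (mapRight N g))
    (g := (mapRight P g).comp (map R X f)) (hom_ext fun _ _ => rfl) t

theorem map_surjective {f : N →ₗ[Rᵐᵒᵖ] P} (hf : Function.Surjective f) :
    Function.Surjective (map R X f) := by
  intro t
  induction t using induction_on with
  | zero => exact ⟨0, map_zero _⟩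
  | tmul n x => obtain ⟨m, rfl⟩ := hf n; exact ⟨tmul R m x, rfl⟩
  | add s t hs ht =>
    obtain ⟨a, rfl⟩ := hs
    obtain ⟨b, rfl⟩ := ht
    exact ⟨a + b, map_add _ _ _⟩

theorem mapRight_surjective {g : X →ₗ[R] Y} (hg : Function.Surjective g) :
    Function.Surjective (mapRight N g) := by
  intro t
  induction t using induction_on with
  | zero => exact ⟨0, map_zero _⟩
  | tmul n x => obtain ⟨m, rfl⟩ := hg x; exact ⟨tmul R n m, rfl⟩
  | add s t hs ht =>
    obtain ⟨a, rfl⟩ := hs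
    obtain ⟨b, rfl⟩ := ht
    exact ⟨a + b, map_add _ _ _⟩

/-- Each generating relation lifts because its entry in `Y` does. This is what lets right exactness
pass from ℤ to `R`. -/
theorem balancedRelations_le_map_lTensor {g : X →ₗ[R] Y} (hg : Function.Surjective g) :
    balancedRelations R N Y ≤ (balancedRelations R N X).map
      (LinearMap.lTensor N g.toAddMonoidHom.toIntLinearMap).toAddMonoidHom := by
  rw [balancedRelations, AddSubgroup.closure_le]
  rintro _ ⟨n, r, y, rfl⟩
  obtain ⟨x, rfl⟩ := hg y
  refine ⟨_, AddSubgroup.subset_closure ⟨n, r, x, rfl⟩, ?_⟩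
  rw [map_sub, ← map_smul]
  rfl

theorem balancedRelations_le_map_rTensor {f : N →ₗ[Rᵐᵒᵖ] P} (hf : Function.Surjective f) :
    balancedRelations R P X ≤ (balancedRelations R N X).map
      (LinearMap.rTensor X f.toAddMonoidHom.toIntLinearMap).toAddMonoidHom := by
  rw [balancedRelations, AddSubgroup.closure_le]
  rintro _ ⟨n, r, x, rfl⟩
  obtain ⟨n, rfl⟩ := hf n
  refine ⟨_, AddSubgroup.subset_closure ⟨n, r, x, rfl⟩, ?_⟩
  rw [map_sub, ← map_smul]
  rfl

/-- `N ⊗_R -` is right exact. -/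
theorem mapRight_exact {f : X →ₗ[R] Y} {g : Y →ₗ[R] Z} (hfg : Function.Exact f g)
    (hg : Function.Surjective g) : Function.Exact (mapRight N f) (mapRight N g) := by
  have hT := lTensor_exact N (f := f.toAddMonoidHom.toIntLinearMap)
    (g := g.toAddMonoidHom.toIntLinearMap) hfg hg
  intro t
  constructor
  · obtain ⟨t, rfl⟩ := QuotientAddGroup.mk_surjective t
    intro ht
    -- The image of `t` is a relation, hence the image of a relation `r`. So `t - r` dies already
    -- over ℤ, and has the same class as `t`.
    obtain ⟨r, hr, hrt⟩ := balancedRelations_le_map_lTensor (N := N) hg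
      ((QuotientAddGroup.eq_zero_iff _).1 ht)
    obtain ⟨w, hw⟩ := (hT (t - r)).1 ((map_sub _ t r).trans (sub_eq_zero.2 hrt.symm))
    refine ⟨QuotientAddGroup.mk w, (congrArg QuotientAddGroup.mk hw).trans ?_⟩
    rw [QuotientAddGroup.mk_sub, (QuotientAddGroup.eq_zero_iff r).2 hr, sub_zero]
  · rintro ⟨s, rfl⟩
    induction s using induction_on with
    | zero => simp
    | tmul n x => simp [hfg.apply_apply_eq_zero x]
    | add s t hs ht => rw [map_add, map_add, hs, ht, add_zero]

/-- `- ⊗_R X` is right exact. -/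
theorem map_exact {f : N →ₗ[Rᵐᵒᵖ] P} {g : P →ₗ[Rᵐᵒᵖ] Q} (hfg : Function.Exact f g)
    (hg : Function.Surjective g) : Function.Exact (map R X f) (map R X g) := by
  have hT := rTensor_exact X (f := f.toAddMonoidHom.toIntLinearMap)
    (g := g.toAddMonoidHom.toIntLinearMap) hfg hg
  intro t
  constructor
  · obtain ⟨t, rfl⟩ := QuotientAddGroup.mk_surjective t
    intro ht
    obtain ⟨r, hr, hrt⟩ := balancedRelations_le_map_rTensor (X := X) hg
      ((QuotientAddGroup.eq_zero_iff _).1 ht)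
    obtain ⟨w, hw⟩ := (hT (t - r)).1 ((map_sub _ t r).trans (sub_eq_zero.2 hrt.symm))
    refine ⟨QuotientAddGroup.mk w, (congrArg QuotientAddGroup.mk hw).trans ?_⟩
    rw [QuotientAddGroup.mk_sub, (QuotientAddGroup.eq_zero_iff r).2 hr, sub_zero]
  · rintro ⟨s, rfl⟩
    induction s using induction_on with
    | zero => simp
    | tmul n x => simp [hfg.apply_apply_eq_zero n]
    | add s t hs ht => rw [map_add, map_add, hs, ht, add_zero]

/-- The functor `F ⊗_R -` preserves injectivity if `F` is a free right module. -/
theorem mapRight_injective_of_finsupp (J : Type u) {g : X →ₗ[R] Y} (hg : Function.Injective g) :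
    Function.Injective (mapRight (J →₀ Rᵐᵒᵖ) g) := by
  -- Coordinates: `φ` sends f ⊗ w to the family f(j) • w, naturally in `W`, and `ψ` inverts it on
  -- the left. Injectivity then reduces to that of `g` in each coordinate.
  let φ (W : Type u) [AddCommGroup W] [Module R W] :
      BalancedTensor R (J →₀ Rᵐᵒᵖ) W →+ (J →₀ W) :=
    lift (AddMonoidHom.mk' (fun f => AddMonoidHom.mk'
        (fun w => f.mapRange (fun r => r.unop • w) (by simp)) fun v w => by ext; simp)
        fun f g => by ext; simp [add_smul]) fun f r w => by ext; simp [mul_smul]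
  let ψ : (J →₀ X) →+ BalancedTensor R (J →₀ Rᵐᵒᵖ) X :=
    Finsupp.liftAddHom fun j => AddMonoidHom.mk' (fun x => tmul R (Finsupp.single j 1) x)
      fun x y => tmul_add _ x y
  have hψ : ∀ t, ψ (φ X t) = t := by
    intro t
    induction t using induction_on with
    | zero => simp
    | add s t hs ht => rw [map_add, map_add, hs, ht]
    | tmul f x =>
      induction f using Finsupp.induction_linear with
      | zero =>
        rw [zero_tmul, map_zero, map_zero]
      | add f g hf hg => rw [add_tmul, map_add, map_add, hf, hg]
      | single j r =>
        have h₁ : φ X (tmul R (Finsupp.single j r) x) = Finsupp.single j (r.unop • x) :=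
          Finsupp.mapRange_single (hf := by simp)
        rw [h₁, Finsupp.liftAddHom_apply_single]
        change tmul R _ (r.unop • x) = _
        rw [← smul_tmul]
        simp
  have hnat : ∀ t, φ Y (mapRight _ g t) = (φ X t).mapRange g (map_zero g) := by
    intro t
    induction t using induction_on with
    | zero => simp
    | add s t hs ht =>
      rw [map_add, map_add, hs, ht, map_add, Finsupp.mapRange_add (map_add g)]
    | tmul f x => ext j; exact (map_smul g (f j).unop x).symm
  intro s t hst
  have h := congrArg (φ Y) hst
  rw [hnat, hnat] at h
  rw [← hψ s, ← hψ t, Finsupp.mapRange_injective g (map_zero g) hg h]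

end BalancedTensor

/-! ### Flat modules in short exact sequences, without Tor. -/

section FlatModules

open BalancedTensor

variable {R : Type u} [Ring R]

/-- Free modules are flat. -/
theorem isFlatModule_finsupp (J : Type u) : IsFlatModule R (J →₀ R) := by
  intro N P _ _ _ _ g hg
  let φ (W : Type u) [AddCommGroup W] [Module Rᵐᵒᵖ W] :
      BalancedTensor R W (J →₀ R) →+ (J →₀ W) :=
    lift (AddMonoidHom.mk' (fun w => AddMonoidHom.mk'
        (fun f => f.mapRange (fun r => w <• r) (by simp)) fun v w => by ext; simp [add_smul])
        fun f g => by ext; simp) fun f r w => by ext; simp [mul_smul]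
  let ψ : (J →₀ N) →+ BalancedTensor R N (J →₀ R) :=
    Finsupp.liftAddHom fun j => AddMonoidHom.mk' (fun x => tmul R x (Finsupp.single j 1))
      fun x y => add_tmul x y _
  have hψ : ∀ t, ψ (φ N t) = t := by
    intro t
    induction t using induction_on with
    | zero => simp
    | add s t hs ht => rw [map_add, map_add, hs, ht]
    | tmul x f =>
      induction f using Finsupp.induction_linear with
      | zero =>
        rw [tmul_zero, map_zero, map_zero]
      | add f g hf hg => rw [tmul_add, map_add, map_add, hf, hg]
      | single j r =>
        have h₁ : φ N (tmul R x (Finsupp.single j r)) = Finsupp.single j (x <• r) :=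
          Finsupp.mapRange_single (hf := by simp)
        rw [h₁, Finsupp.liftAddHom_apply_single]
        change tmul R (x <• r) _ = _
        rw [smul_tmul]
        simp
  have hnat : ∀ t, φ P (map R _ g t) = (φ N t).mapRange g (map_zero g) := by
    intro t
    induction t using induction_on with
    | zero => simp
    | add s t hs ht =>
      rw [map_add, map_add, hs, ht, map_add, Finsupp.mapRange_add (map_add g)]
    | tmul x f => ext j; exact (map_smul g (MulOpposite.op (f j)) x).symm
  intro s t hst
  have h := congrArg (φ P) hst
  rw [hnat, hnat] at h
  rw [← hψ s, ← hψ t, Finsupp.mapRange_injective g (map_zero g) hg h]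

section ShortExact

variable {X Y Z : Type u} [AddCommGroup X] [Module R X] [AddCommGroup Y] [Module R Y]
  [AddCommGroup Z] [Module R Z] {f : X →ₗ[R] Y} {g : Y →ₗ[R] Z}

/-- If `0 → X → Y → Z → 0` is exact and `Z` is flat, injectivity of `F ⊗_R X → F ⊗_R Y` descends to
quotients of `F`. -/
theorem IsFlatModule.mapRight_injective_of_surjective (hZ : IsFlatModule R Z)
    (hfg : Function.Exact f g) (hg : Function.Surjective g)
    {F N : Type u} [AddCommGroup F] [Module Rᵐᵒᵖ F] [AddCommGroup N] [Module Rᵐᵒᵖ N]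
    {p : F →ₗ[Rᵐᵒᵖ] N} (hp : Function.Surjective p)
    (hF : Function.Injective (mapRight F f)) : Function.Injective (mapRight N f) := by
  have hip : Function.Exact (LinearMap.ker p).subtype p := LinearMap.exact_subtype_ker_map p
  rw [injective_iff_map_eq_zero]
  -- Chase in the grid of `ker p`, `F`, `N` against `X`, `Y`, `Z`: lift `t` to `u` in F ⊗ X, whose
  -- image in F ⊗ Y comes from `w` in ker p ⊗ Y. Flatness of `Z` makes `w` vanish in ker p ⊗ Z, so
  -- `w` comes from ker p ⊗ X; by `hF` so does `u`, and `t = 0`.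
  intro t ht
  obtain ⟨u, rfl⟩ := map_surjective hp t
  rw [← map_mapRight] at ht
  obtain ⟨w, hw⟩ := (map_exact hip hp _).1 ht
  have hw' : mapRight _ g w = 0 := by
    apply hZ _ _ _ (LinearMap.ker p).subtype_injective
    rw [map_mapRight, hw, map_zero]
    exact (mapRight_exact hfg hg).apply_apply_eq_zero u
  obtain ⟨y, rfl⟩ := (mapRight_exact hfg hg w).1 hw'
  rw [map_mapRight] at hw
  rw [← hF hw]
  exact (map_exact hip hp _).2 ⟨y, rfl⟩

/-- If `0 → X → Y → Z → 0` is exact and `Z` is flat, then `N ⊗_R X → N ⊗_R Y` is injective. -/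
theorem IsFlatModule.mapRight_injective (hZ : IsFlatModule R Z) (hf : Function.Injective f)
    (hfg : Function.Exact f g) (hg : Function.Surjective g)
    (N : Type u) [AddCommGroup N] [Module Rᵐᵒᵖ N] : Function.Injective (mapRight N f) :=
  -- Here `F` is the free right module on the elements of `N`.
  hZ.mapRight_injective_of_surjective hfg hg
    (Finsupp.linearCombination_id_surjective Rᵐᵒᵖ N) (mapRight_injective_of_finsupp N hf)

/-- If `0 → X → Y → Z → 0` is exact and `Y` and `Z` are flat, then so is `X`. -/
theorem IsFlatModule.of_exact (hY : IsFlatModule R Y) (hZ : IsFlatModule R Z)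
    (hf : Function.Injective f) (hfg : Function.Exact f g) (hg : Function.Surjective g) :
    IsFlatModule R X := by
  intro N P _ _ _ _ j hj s t hst
  -- The composite N ⊗ X → N ⊗ Y → P ⊗ Y is injective, and it factors through N ⊗ X → P ⊗ X.
  apply hZ.mapRight_injective hf hfg hg N
  apply hY N P j hj
  rw [map_mapRight, map_mapRight, hst]

end ShortExact

end FlatModules

/-! ### Extension of scalars along a ring homomorphism. -/

section BaseChange

open BalancedTensor

variable {A B C : Type u} [Ring A] [Ring B] [Ring C] (ρ : A →+* B)

/-- The right `A`-module obtained from a right `B`-module by restriction of scalars along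
`ρ : A → B`. -/
def RightRestrict (_ρ : A →+* B) (N : Type u) : Type u := N

namespace RightRestrict

variable {N P : Type u} [AddCommGroup N] [Module Bᵐᵒᵖ N] [AddCommGroup P] [Module Bᵐᵒᵖ P]

instance : AddCommGroup (RightRestrict ρ N) := inferInstanceAs (AddCommGroup N)

instance : Module Aᵐᵒᵖ (RightRestrict ρ N) := Module.compHom N ρ.op

/-- The identity, as a map from a right `B`-module to its restriction of scalars. -/
def of : N →+ RightRestrict ρ N := AddMonoidHom.id N

theorem of_smul (n : N) (a : A) : of ρ n <• a = of ρ (n <• ρ a) := rfl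

/-- A homomorphism of right `B`-modules as a homomorphism of right `A`-modules. -/
def map (f : N →ₗ[Bᵐᵒᵖ] P) : RightRestrict ρ N →ₗ[Aᵐᵒᵖ] RightRestrict ρ P where
  toFun := f
  map_add' := f.map_add
  map_smul' a n := f.map_smul (ρ.op a) n

theorem map_of (f : N →ₗ[Bᵐᵒᵖ] P) (n : N) : map ρ f (of ρ n) = of ρ (f n) := rfl

end RightRestrict

open RightRestrict (of)

/-- The extension of scalars `B ⊗_A X` of a left `A`-module `X` along `ρ : A → B`. -/
def BaseChange (X : Type u) [AddCommGroup X] [Module A X] : Type u :=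
  BalancedTensor A (RightRestrict ρ B) X

namespace BaseChange

variable {X Y Z : Type u} [AddCommGroup X] [Module A X] [AddCommGroup Y] [Module A Y]
  [AddCommGroup Z] [Module A Z]

instance : AddCommGroup (BaseChange ρ X) :=
  inferInstanceAs (AddCommGroup (BalancedTensor A (RightRestrict ρ B) X))

/-- The elementary tensor `b ⊗ x` in `B ⊗_A X`. -/
def tmul (b : B) (x : X) : BaseChange ρ X :=
  BalancedTensor.tmul A (of ρ b) x

theorem tmul_add (b : B) (x y : X) : tmul ρ b (x + y) = tmul ρ b x + tmul ρ b y :=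
  BalancedTensor.tmul_add (of ρ b) x y

theorem add_tmul (b c : B) (x : X) : tmul ρ (b + c) x = tmul ρ b x + tmul ρ c x :=
  BalancedTensor.add_tmul (of ρ b) (of ρ c) x

theorem zero_tmul (x : X) : tmul ρ (0 : B) x = 0 :=
  BalancedTensor.zero_tmul (N := RightRestrict ρ B) x

theorem mul_tmul (b : B) (a : A) (x : X) : tmul ρ (b * ρ a) x = tmul ρ b (a • x) :=
  BalancedTensor.smul_tmul (of ρ b) a x

variable {ρ} in
@[elab_as_elim]
theorem induction_on {p : BaseChange ρ X → Prop} (t : BaseChange ρ X)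
    (zero : p 0) (tmul : ∀ b x, p (tmul ρ b x)) (add : ∀ s t, p s → p t → p (s + t)) : p t :=
  BalancedTensor.induction_on (R := A) (N := RightRestrict ρ B) (X := X) t zero tmul add

variable {ρ} in
theorem addHom_ext {G : Type*} [AddCommGroup G] {f g : BaseChange ρ X →+ G}
    (h : ∀ b x, f (tmul ρ b x) = g (tmul ρ b x)) : f = g := by
  refine DFunLike.ext _ _ fun t => ?_
  induction t using induction_on with
  | zero => rw [map_zero, map_zero]
  | tmul b x => exact h b x
  | add s t hs ht => rw [map_add, map_add, hs, ht]

/-- The additive map on `B ⊗_A X` given by a balanced biadditive map on `B × X`. -/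
def liftAddHom {G : Type*} [AddCommGroup G] (f : B →+ X →+ G)
    (hf : ∀ b a x, f (b * ρ a) x = f b (a • x)) : BaseChange ρ X →+ G :=
  BalancedTensor.lift (R := A) (N := RightRestrict ρ B) f hf

@[simp] theorem liftAddHom_tmul {G : Type*} [AddCommGroup G] (f : B →+ X →+ G)
    (hf : ∀ b a x, f (b * ρ a) x = f b (a • x)) (b : B) (x : X) :
    liftAddHom ρ f hf (tmul ρ b x) = f b x := rfl

/-- The multiplication by `b` on `B ⊗_A X`. -/
def smulHom (X : Type u) [AddCommGroup X] [Module A X] (b : B) :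
    BaseChange ρ X →+ BaseChange ρ X :=
  liftAddHom ρ
    (AddMonoidHom.mk' (fun c => AddMonoidHom.mk' (fun x => tmul ρ (b * c) x)
      fun x y => tmul_add ρ _ x y) fun c d => AddMonoidHom.ext fun x => by
        change tmul ρ (b * (c + d)) x = tmul ρ (b * c) x + tmul ρ (b * d) x
        rw [mul_add, add_tmul])
    fun c a x => by
      change tmul ρ (b * (c * ρ a)) x = tmul ρ (b * c) (a • x)
      rw [← mul_assoc, mul_tmul]

instance : SMul B (BaseChange ρ X) := ⟨fun b => smulHom ρ X b⟩

@[simp] theorem smul_tmul (b c : B) (x : X) : b • tmul ρ c x = tmul ρ (b * c) x := rfl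

instance : Module B (BaseChange ρ X) where
  smul_zero b := map_zero (smulHom ρ X b)
  smul_add b := map_add (smulHom ρ X b)
  one_smul t := DFunLike.congr_fun (f := smulHom ρ X 1) (g := AddMonoidHom.id _)
    (addHom_ext fun b x => congrArg (tmul ρ · x) (one_mul b)) t
  mul_smul b c t := DFunLike.congr_fun (f := smulHom ρ X (b * c))
    (g := (smulHom ρ X b).comp (smulHom ρ X c))
    (addHom_ext fun d x => congrArg (tmul ρ · x) (mul_assoc b c d)) t
  add_smul b c t := DFunLike.congr_fun (f := smulHom ρ X (b + c))
    (g := smulHom ρ X b + smulHom ρ X c)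
    (addHom_ext fun d x => (congrArg (tmul ρ · x) (add_mul b c d)).trans (add_tmul ρ _ _ x)) t
  zero_smul t := DFunLike.congr_fun (f := smulHom ρ X 0) (g := 0)
    (addHom_ext fun d x => (congrArg (tmul ρ · x) (zero_mul d)).trans (zero_tmul ρ x)) t

/-- The canonical map `X → B ⊗_A X`. -/
def unit (X : Type u) [AddCommGroup X] [Module A X] : X →ₛₗ[ρ] BaseChange ρ X where
  toFun x := tmul ρ 1 x
  map_add' x y := tmul_add ρ 1 x y
  map_smul' a x := by rw [← mul_tmul, one_mul, smul_tmul, mul_one]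

theorem tmul_eq_smul_unit (b : B) (x : X) : tmul ρ b x = b • unit ρ X x :=
  congrArg (tmul ρ · x) (mul_one b).symm

variable {ρ}

/-- The semilinear map `b ⊗ x ↦ τ b • f x` on `B ⊗_A X`. -/
def lift {τ : B →+* C} {κ : A →+* C} [RingHomCompTriple ρ τ κ] {W : Type u} [AddCommGroup W]
    [Module C W] (f : X →ₛₗ[κ] W) : BaseChange ρ X →ₛₗ[τ] W where
  __ := liftAddHom ρ
    (AddMonoidHom.mk' (fun b => AddMonoidHom.mk' (fun x => τ b • f x)
      fun x y => by simp) fun c d => by ext x; simp [add_smul])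
    fun b a x => by simp [mul_smul, RingHomCompTriple.comp_apply]
  map_smul' b t := by
    induction t using induction_on with
    | zero => simp
    | tmul c x => simp [mul_smul]
    | add s t hs ht => simp_all

@[simp] theorem lift_tmul {τ : B →+* C} {κ : A →+* C} [RingHomCompTriple ρ τ κ] {W : Type u}
    [AddCommGroup W] [Module C W] (f : X →ₛₗ[κ] W) (b : B) (x : X) :
    lift (τ := τ) f (tmul ρ b x) = τ b • f x := rfl

@[simp] theorem lift_unit {τ : B →+* C} {κ : A →+* C} [RingHomCompTriple ρ τ κ] {W : Type u}
    [AddCommGroup W] [Module C W] (f : X →ₛₗ[κ] W) (x : X) :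
    lift (τ := τ) f (unit ρ X x) = f x :=
  (lift_tmul f 1 x).trans (by simp)

variable (ρ) in
/-- The map `B ⊗_A X → B ⊗_A Y` induced by a homomorphism `X → Y`. -/
def map (f : X →ₗ[A] Y) : BaseChange ρ X →ₗ[B] BaseChange ρ Y :=
  lift ((unit ρ Y).comp f)

@[simp] theorem map_tmul (f : X →ₗ[A] Y) (b : B) (x : X) :
    map ρ f (tmul ρ b x) = tmul ρ b (f x) :=
  (tmul_eq_smul_unit ρ b (f x)).symm

theorem map_apply (f : X →ₗ[A] Y) (t : BaseChange ρ X) :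
    map ρ f t = mapRight (RightRestrict ρ B) f t :=
  DFunLike.congr_fun (f := (map ρ f).toAddMonoidHom)
    (g := (mapRight (RightRestrict ρ B) f : BaseChange ρ X →+ BaseChange ρ Y))
    (addHom_ext fun b x => map_tmul f b x) t

theorem map_surjective {f : X →ₗ[A] Y} (hf : Function.Surjective f) :
    Function.Surjective (map ρ f) := fun t =>
  (mapRight_surjective (N := RightRestrict ρ B) hf t).imp fun s hs => (map_apply f s).trans hs

theorem map_exact {f : X →ₗ[A] Y} {g : Y →ₗ[A] Z} (hfg : Function.Exact f g)
    (hg : Function.Surjective g) : Function.Exact (map ρ f) (map ρ g) := fun t => by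
  rw [map_apply]
  refine (mapRight_exact (N := RightRestrict ρ B) hfg hg t).trans
    (exists_congr fun s => ?_)
  exact (map_apply f s).symm ▸ Iff.rfl

/-- Flatness of the quotient `Z` suffices: the sequence stays exact under B ⊗_A - for an arbitrary
`B`. -/
theorem map_injective {f : X →ₗ[A] Y} {g : Y →ₗ[A] Z} (hZ : IsFlatModule A Z)
    (hf : Function.Injective f) (hfg : Function.Exact f g) (hg : Function.Surjective g) :
    Function.Injective (map ρ f) := fun s t h =>
  hZ.mapRight_injective hf hfg hg (RightRestrict ρ B) <| by
    rw [map_apply, map_apply] at h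
    exact h

variable (ρ)

/-- The map `b ⊗ x ↦ n <• b ⊗ x` from `B ⊗_A X` to `N ⊗_A X`. -/
def contractAt (X : Type u) [AddCommGroup X] [Module A X] {N : Type u} [AddCommGroup N]
    [Module Bᵐᵒᵖ N] (n : N) : BaseChange ρ X →+ BalancedTensor A (RightRestrict ρ N) X :=
  liftAddHom ρ (AddMonoidHom.mk' (fun b => AddMonoidHom.mk'
      (fun x => BalancedTensor.tmul A (of ρ (n <• b)) x)
      fun x y => BalancedTensor.tmul_add _ x y)
      fun b c => AddMonoidHom.ext fun x => by
        change BalancedTensor.tmul A (of ρ (n <• (b + c))) x =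
          BalancedTensor.tmul A (of ρ (n <• b)) x + BalancedTensor.tmul A (of ρ (n <• c)) x
        rw [MulOpposite.op_add, add_smul, map_add, BalancedTensor.add_tmul])
    fun b a x => by
      change BalancedTensor.tmul A (of ρ (n <• (b * ρ a))) x =
        BalancedTensor.tmul A (of ρ (n <• b)) (a • x)
      rw [← BalancedTensor.smul_tmul, RightRestrict.of_smul, MulOpposite.op_mul, mul_smul]

theorem contractAt_tmul {N : Type u} [AddCommGroup N] [Module Bᵐᵒᵖ N] (n : N) (b : B) (x : X) :
    contractAt ρ X n (tmul ρ b x) = BalancedTensor.tmul A (of ρ (n <• b)) x := rfl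

/-- The map `n ⊗ (b ⊗ x) ↦ n <• b ⊗ x` from `N ⊗_B (B ⊗_A X)` to `N ⊗_A X`. -/
def contract (X N : Type u) [AddCommGroup X] [Module A X] [AddCommGroup N] [Module Bᵐᵒᵖ N] :
    BalancedTensor B N (BaseChange ρ X) →+ BalancedTensor A (RightRestrict ρ N) X :=
  BalancedTensor.lift
    (AddMonoidHom.mk' (contractAt ρ X) fun m n => addHom_ext fun b x => by
      rw [AddMonoidHom.add_apply, contractAt_tmul, contractAt_tmul, contractAt_tmul, smul_add,
        (of ρ).map_add, BalancedTensor.add_tmul])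
    fun n b t => DFunLike.congr_fun (f := contractAt ρ X (n <• b))
      (g := (contractAt ρ X n).comp (smulHom ρ X b)) (addHom_ext fun c x => by
        change _ = contractAt ρ X n (tmul ρ (b * c) x)
        rw [contractAt_tmul, contractAt_tmul, MulOpposite.op_mul, mul_smul]) t

/-- The inverse sends n ⊗ x to n ⊗ (1 ⊗ x); the balancing relation moves b across the tensor sign.
Together with naturality in `N`, this gives flatness of B ⊗_A X. -/
theorem contract_injective (X N : Type u) [AddCommGroup X] [Module A X] [AddCommGroup N]
    [Module Bᵐᵒᵖ N] : Function.Injective (contract ρ X N) := by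
  let tm (n : N) : BaseChange ρ X →+ BalancedTensor B N (BaseChange ρ X) :=
    AddMonoidHom.mk' (BalancedTensor.tmul B n) (BalancedTensor.tmul_add n)
  let ψ : BalancedTensor A (RightRestrict ρ N) X →+ BalancedTensor B N (BaseChange ρ X) :=
    BalancedTensor.lift (AddMonoidHom.mk' (fun n : N => (tm n).comp (unit ρ X).toAddMonoidHom)
        fun (m n : N) => AddMonoidHom.ext fun x => BalancedTensor.add_tmul m n (unit ρ X x))
      fun (n : N) a x => by
        change BalancedTensor.tmul B (n <• ρ a) (unit ρ X x) =
          BalancedTensor.tmul B n (unit ρ X (a • x))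
        rw [BalancedTensor.smul_tmul, LinearMap.map_smulₛₗ]
  have hψ : ψ.comp (contract ρ X N) = AddMonoidHom.id _ :=
    BalancedTensor.hom_ext fun n t => by
      refine DFunLike.congr_fun (f := ψ.comp (contractAt ρ X n)) (g := tm n)
        (addHom_ext fun b x => ?_) t
      change BalancedTensor.tmul B (n <• b) (unit ρ X x) = BalancedTensor.tmul B n (tmul ρ b x)
      rw [tmul_eq_smul_unit, BalancedTensor.smul_tmul]
  exact Function.LeftInverse.injective (g := ψ) (DFunLike.congr_fun hψ)

theorem contract_map {N P : Type u} [AddCommGroup N] [Module Bᵐᵒᵖ N] [AddCommGroup P]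
    [Module Bᵐᵒᵖ P] (f : N →ₗ[Bᵐᵒᵖ] P) (t : BalancedTensor B N (BaseChange ρ X)) :
    contract ρ X P (BalancedTensor.map B _ f t) =
      BalancedTensor.map A X (RightRestrict.map ρ f) (contract ρ X N t) := by
  refine DFunLike.congr_fun (f := (contract ρ X P).comp (BalancedTensor.map B _ f))
    (g := (BalancedTensor.map A X (RightRestrict.map ρ f)).comp (contract ρ X N))
    (BalancedTensor.hom_ext fun n t => ?_) t
  refine DFunLike.congr_fun (f := contractAt ρ X (f n))
    (g := (BalancedTensor.map A X (RightRestrict.map ρ f)).comp (contractAt ρ X n))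
    (addHom_ext fun b x => ?_) t
  rw [AddMonoidHom.comp_apply, contractAt_tmul, contractAt_tmul, BalancedTensor.map_tmul,
    RightRestrict.map_of, f.map_smul]

/-- Extension of scalars preserves flatness. -/
theorem isFlatModule (hX : IsFlatModule A X) : IsFlatModule B (BaseChange ρ X) := by
  intro N P _ _ _ _ f hf s t hst
  apply contract_injective ρ X N
  apply hX _ _ (RightRestrict.map ρ f) hf
  rw [← contract_map, ← contract_map, hst]

end BaseChange

/-- Lifting semilinear maps from a projective module along a surjection. -/
theorem Module.Projective.exists_semilinear_lift {A B C P M N : Type u} [Ring A] [Ring B] [Ring C]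
    {σ : A →+* B} {τ : B →+* C} {κ : A →+* C} [RingHomCompTriple σ τ κ]
    [AddCommGroup P] [Module A P] [Module.Projective A P] [AddCommGroup M] [Module B M]
    [AddCommGroup N] [Module C N] (f : M →ₛₗ[τ] N) (hf : Function.Surjective f)
    (g : P →ₛₗ[κ] N) : ∃ h : P →ₛₗ[σ] M, ∀ p, f (h p) = g p := by
  -- Restricting scalars along `σ` and `κ` makes every map `A`-linear, so ordinary lifting applies.
  let _ : Module A M := Module.compHom M σ
  let _ : Module A N := Module.compHom N κ
  let f' : M →ₗ[A] N :=
    { f with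
      map_smul' := fun a m => (map_smulₛₗ f (σ a) m).trans <| by
        rw [RingHomCompTriple.comp_apply]
        rfl }
  let g' : P →ₗ[A] N := { g with map_smul' := fun a p => map_smulₛₗ g a p }
  obtain ⟨h, hh⟩ := Module.projective_lifting_property f' g' hf
  exact ⟨{ h with map_smul' := fun a p => map_smul h a p }, fun p => DFunLike.congr_fun hh p⟩

/-- Extension of scalars preserves projectivity. -/
theorem BaseChange.projective (P : Type u) [AddCommGroup P] [Module A P] [Module.Projective A P] :
    Module.Projective B (BaseChange ρ P) := by
  refine .of_lifting_property'' fun f hf => ?_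
  -- Lift p ↦ 1 ⊗ p through `f`, then extend `B`-linearly.
  obtain ⟨h, hh⟩ := Module.Projective.exists_semilinear_lift (σ := ρ) f hf (unit ρ P)
  refine ⟨lift h, LinearMap.ext fun t => ?_⟩
  induction t using BaseChange.induction_on with
  | zero => simp
  | tmul b p => simp [hh, tmul_eq_smul_unit]
  | add s t hs ht => rw [map_add, map_add, hs, ht]

end BaseChange

/-! ### Reduction along a split surjection with nilpotent kernel. -/

section NilpotentKernel

variable {R S : Type u} [Ring R] [Ring S] {π : S →+* R} {σ : R →+* S}
  [RingHomCompTriple σ π (RingHom.id R)]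

open BaseChange

/-- If `σ : R → S` is a section of `π : S → R`, then `R ⊗_S (S ⊗_R Y)` is isomorphic to `Y`. -/
theorem bijective_lift_lift (Y : Type u) [AddCommGroup Y] [Module R Y] :
    Function.Bijective (BaseChange.lift (ρ := π) (τ := RingHom.id R)
      (BaseChange.lift (ρ := σ) (τ := π) (LinearMap.id : Y →ₗ[R] Y))) := by
  -- The candidate inverse is y ↦ 1 ⊗ (1 ⊗ y); it is onto because r ⊗ (s ⊗ y) is the image of (r
  -- π(s)) • y.
  let e : Y →+ BaseChange π (BaseChange σ Y) :=
    (unit π (BaseChange σ Y)).toAddMonoidHom.comp (unit σ Y).toAddMonoidHom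
  have he (r : R) (y : Y) : e (r • y) = r • e y := by
    change unit π _ (unit σ Y (r • y)) = r • unit π _ (unit σ Y y)
    rw [map_smulₛₗ, map_smulₛₗ, RingHomCompTriple.comp_apply (σ₁₃ := RingHom.id R),
      RingHom.id_apply]
  have hes : Function.Surjective e := by
    intro t
    induction t using BaseChange.induction_on with
    | zero => exact ⟨0, map_zero e⟩
    | add s t hs ht =>
      obtain ⟨x, rfl⟩ := hs
      obtain ⟨y, rfl⟩ := ht
      exact ⟨x + y, map_add e x y⟩
    | tmul r t =>
      induction t using BaseChange.induction_on with
      | zero => exact ⟨0, by rw [map_zero, tmul_eq_smul_unit, map_zero, smul_zero]⟩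
      | add s t hs ht =>
        obtain ⟨x, hx⟩ := hs
        obtain ⟨y, hy⟩ := ht
        exact ⟨x + y, by rw [map_add, hx, hy, tmul_add]⟩
      | tmul s y =>
        refine ⟨(r * π s) • y, ?_⟩
        rw [he, tmul_eq_smul_unit, tmul_eq_smul_unit, map_smulₛₗ, smul_smul]
        rfl
  have hle (y : Y) : BaseChange.lift (ρ := π) (τ := RingHom.id R)
      (BaseChange.lift (ρ := σ) (τ := π) (LinearMap.id : Y →ₗ[R] Y)) (e y) = y :=
    (lift_unit _ _).trans (lift_unit _ _)
  refine ⟨fun s t hst => ?_, fun y => ⟨e y, hle y⟩⟩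
  obtain ⟨x, rfl⟩ := hes s
  obtain ⟨y, rfl⟩ := hes t
  rw [hle, hle] at hst
  rw [hst]

include σ in
/-- Nakayama's lemma for a split surjection with nilpotent kernel. -/
theorem subsingleton_of_subsingleton_baseChange {m : ℕ} (hm : RingHom.ker π ^ m = ⊥)
    (Z : Type u) [AddCommGroup Z] [Module S Z] [Subsingleton (BaseChange π Z)] :
    Subsingleton Z := by
  set I : Ideal S := RingHom.ker π
  -- The map r ⊗ z ↦ [σ(r) z] is balanced since σ(r π(s)) - σ(r) s lies in `I`. Hence R ⊗_S Z = 0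
  -- forces Z = I Z, and iterating, Z = I^m Z = 0.
  let q : BaseChange π Z →+ Z ⧸ (I • ⊤ : Submodule S Z) :=
    liftAddHom π (AddMonoidHom.mk' (fun r => AddMonoidHom.mk'
      (fun z => Submodule.Quotient.mk (σ r • z)) fun x y => by simp)
      fun r s => by ext z; simp [add_smul])
      fun r s z => by
        change Submodule.Quotient.mk _ = Submodule.Quotient.mk _
        rw [Submodule.Quotient.eq, smul_smul, ← sub_smul]
        refine Submodule.smul_mem_smul ?_ Submodule.mem_top
        simp [I, RingHom.mem_ker, RingHomCompTriple.comp_apply (σ₁₃ := RingHom.id R)]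
  have h₁ : (⊤ : Submodule S Z) ≤ I • ⊤ := fun z _ => by
    have h : q (tmul π 1 z) = 0 := by rw [Subsingleton.elim (tmul π 1 z) 0, map_zero]
    have h' : q (tmul π 1 z) = Submodule.Quotient.mk (σ 1 • z) := rfl
    rwa [h', map_one, one_smul, Submodule.Quotient.mk_eq_zero] at h
  have h₂ (j : ℕ) : (⊤ : Submodule S Z) ≤ I ^ j • ⊤ := by
    induction j with
    | zero => rw [Submodule.pow_zero, Ideal.one_eq_top, Submodule.top_smul]
    | succ j ih =>
      rw [Submodule.pow_succ, ← Ideal.smul_eq_mul, Submodule.smul_assoc]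
      exact ih.trans (Submodule.smul_mono le_rfl h₁)
  have h₃ := h₂ m
  rw [hm, Submodule.bot_smul] at h₃
  exact (Submodule.subsingleton_iff S).1 (subsingleton_of_bot_eq_top (le_antisymm bot_le h₃))

include σ in
/-- A flat module whose reduction modulo a nilpotent ideal with a complementary subring is
projective is itself projective. -/
theorem IsFlatModule.projective_of_baseChange {m : ℕ} (hm : RingHom.ker π ^ m = ⊥)
    {K : Type u} [AddCommGroup K] [Module S K] (hK : IsFlatModule S K)
    [Module.Projective R (BaseChange π K)] : Module.Projective S K := by
  have hπ : Function.Surjective π :=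
    fun r => ⟨σ r, RingHomCompTriple.comp_apply (σ₁₃ := RingHom.id R)⟩
  have hunit : Function.Surjective (unit π K) := by
    intro t
    induction t using BaseChange.induction_on with
    | zero => exact ⟨0, map_zero _⟩
    | tmul r x =>
      obtain ⟨s, rfl⟩ := hπ r
      exact ⟨s • x, by rw [map_smulₛₗ, tmul_eq_smul_unit]⟩
    | add s t hs ht =>
      obtain ⟨x, rfl⟩ := hs
      obtain ⟨y, rfl⟩ := ht
      exact ⟨x + y, map_add _ x y⟩
  -- `h` is a section of K → R ⊗_S K, linear for the `R`-structure on `K` through `σ`.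
  obtain ⟨h, hh⟩ := Module.Projective.exists_semilinear_lift (σ := σ) (unit π K) hunit
    (LinearMap.id : BaseChange π K →ₗ[R] BaseChange π K)
  let g : BaseChange σ (BaseChange π K) →ₗ[S] K := BaseChange.lift h
  -- As `h` is a section, R ⊗_S g is the canonical isomorphism of `bijective_lift_lift`.
  have hg : Function.Bijective (BaseChange.map π g) := by
    convert bijective_lift_lift (π := π) (σ := σ) (BaseChange π K) using 2
    refine LinearMap.ext fun t => ?_
    induction t using BaseChange.induction_on with
    | zero => simp
    | add s t hs ht => rw [map_add, map_add, hs, ht]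
    | tmul r t =>
      rw [map_tmul, lift_tmul, RingHom.id_apply, tmul_eq_smul_unit]
      congr 1
      induction t using BaseChange.induction_on with
      | zero => simp
      | add s t hs ht => rw [map_add, map_add, map_add, hs, ht]
      | tmul s y =>
        rw [lift_tmul, lift_tmul, map_smulₛₗ, hh]
        rfl
  have hgs : Function.Surjective g := by
    rw [← LinearMap.range_eq_top, ← Submodule.Quotient.subsingleton_iff]
    have : Subsingleton (BaseChange π (K ⧸ LinearMap.range g)) := by
      have hex := BaseChange.map_exact (ρ := π) (LinearMap.exact_map_mkQ_range g)
        (Submodule.mkQ_surjective _)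
      refine subsingleton_of_forall_eq 0 fun t => ?_
      obtain ⟨s, rfl⟩ := BaseChange.map_surjective (ρ := π)
        (Submodule.mkQ_surjective (LinearMap.range g)) t
      exact (hex s).2 (hg.2 s)
    exact subsingleton_of_subsingleton_baseChange (σ := σ) hm _
  -- Since `K` is flat and `g` is onto, R ⊗_S ker g embeds in the source of R ⊗_S g, where it lies
  -- in the kernel, which is zero.
  have hgi : Function.Injective g := by
    rw [← LinearMap.ker_eq_bot, ← Submodule.subsingleton_iff_eq_bot]
    have hker := LinearMap.exact_subtype_ker_map g
    have : Subsingleton (BaseChange π (LinearMap.ker g)) := by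
      refine subsingleton_of_forall_eq 0 fun t => ?_
      apply BaseChange.map_injective (ρ := π) hK (LinearMap.ker g).subtype_injective hker hgs
      apply hg.1
      rw [map_zero, map_zero]
      exact (BaseChange.map_exact hker hgs).apply_apply_eq_zero t
    exact subsingleton_of_subsingleton_baseChange (σ := σ) hm _
  have := BaseChange.projective σ (BaseChange π K)
  exact Module.Projective.of_equiv (LinearEquiv.ofBijective g ⟨hgi, hgs⟩)

end NilpotentKernel

/-! ### Projective dimension of flat modules and `k`-perfectness. -/

section ProjectiveDimension

open CategoryTheory

/-- Dimension shifting: the middle term is projective. -/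
theorem hasProjectiveDimensionLE_succ_iff {R : Type u} [Ring R] {K P X : Type u}
    [AddCommGroup K] [Module R K] [AddCommGroup P] [Module R P] [AddCommGroup X] [Module R X]
    {i : K →ₗ[R] P} {p : P →ₗ[R] X} (hi : Function.Injective i) (hip : Function.Exact i p)
    (hp : Function.Surjective p) [Module.Projective R P] (k : ℕ) :
    HasProjectiveDimensionLE (ModuleCat.of R X) (k + 1) ↔
      HasProjectiveDimensionLE (ModuleCat.of R K) k := by
  have hS := ModuleCat.shortComplex_shortExact
    (ModuleCat.shortComplexOfCompEqZero i p hip.linearMap_comp_eq_zero) hip hi hp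
  exact hS.hasProjectiveDimensionLT_X₃_iff k
    ((IsProjective.iff_projective P).1 inferInstance)

/-- Every module is a quotient of a flat projective module. -/
theorem exists_flat_projective_cover {R : Type u} [Ring R] (X : Type u) [AddCommGroup X]
    [Module R X] : ∃ (F : Type u) (_ : AddCommGroup F) (_ : Module R F) (_ : Module.Projective R F)
      (_ : IsFlatModule R F) (p : F →ₗ[R] X), Function.Surjective p :=
  ⟨X →₀ R, inferInstance, inferInstance, inferInstance, isFlatModule_finsupp X,
    Finsupp.linearCombination R id, Finsupp.linearCombination_id_surjective R X⟩

theorem hasProjectiveDimensionLE_zero_iff {R : Type u} [Ring R] (X : Type u) [AddCommGroup X]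
    [Module R X] :
    HasProjectiveDimensionLE (ModuleCat.of R X) 0 ↔ Module.Projective R X := by
  rw [← projective_iff_hasProjectiveDimensionLE_zero, ← IsProjective.iff_projective]

variable {R S : Type u} [Ring R] [Ring S] {π : S →+* R} {σ : R →+* S}
  [RingHomCompTriple σ π (RingHom.id R)]

include σ in
/-- Reduction modulo a nilpotent ideal with a complementary subring preserves the projective
dimension of flat modules. -/
theorem IsFlatModule.hasProjectiveDimensionLE_baseChange_iff {m : ℕ}
    (hm : RingHom.ker π ^ m = ⊥) (k : ℕ) {X : Type u} [AddCommGroup X] [Module S X]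
    (hX : IsFlatModule S X) :
    HasProjectiveDimensionLE (ModuleCat.of R (BaseChange π X)) k ↔
      HasProjectiveDimensionLE (ModuleCat.of S X) k := by
  induction k generalizing X with
  | zero =>
    rw [hasProjectiveDimensionLE_zero_iff, hasProjectiveDimensionLE_zero_iff]
    exact ⟨fun _ => hX.projective_of_baseChange (σ := σ) hm,
      fun _ => BaseChange.projective π X⟩
  | succ k ih =>
    -- `F` is flat as well as projective, so `ker p` is flat and the induction applies to it.
    obtain ⟨F, _, _, _, hF, p, hp⟩ := exists_flat_projective_cover (R := S) X
    have hi := (LinearMap.ker p).subtype_injective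
    have hip := LinearMap.exact_subtype_ker_map p
    have := BaseChange.projective π F
    rw [hasProjectiveDimensionLE_succ_iff hi hip hp,
      hasProjectiveDimensionLE_succ_iff (BaseChange.map_injective (ρ := π) hX hi hip hp)
        (BaseChange.map_exact hip hp) (BaseChange.map_surjective hp)]
    exact ih (hF.of_exact hX hi hip hp)

include σ in
/-- A split surjection of rings with nilpotent kernel preserves and reflects `k`-perfectness. -/
theorem isKPerfect_iff_of_nilpotent_ker {m : ℕ} (hm : RingHom.ker π ^ m = ⊥) (k : ℕ) :
    IsKPerfect S k ↔ IsKPerfect R k := by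
  constructor
  · intro h X _ _ hX
    -- S ⊗_R X is flat with reduction isomorphic to `X`, so its bound passes to `X`.
    have hX' := BaseChange.isFlatModule σ hX
    have h' := h _ hX'
    rw [projectiveDimension_le_iff] at h' ⊢
    rw [← hX'.hasProjectiveDimensionLE_baseChange_iff (π := π) (σ := σ) hm] at h'
    exact hasProjectiveDimensionLT_of_iso (LinearEquiv.toModuleIso
      (LinearEquiv.ofBijective _ (bijective_lift_lift (π := π) (σ := σ) X))) _
  · intro h X _ _ hX
    have h' := h _ (BaseChange.isFlatModule π hX)
    rw [projectiveDimension_le_iff] at h' ⊢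
    rwa [hX.hasProjectiveDimensionLE_baseChange_iff (σ := σ) hm] at h'

end ProjectiveDimension

/-! ### The trivial extension as a split nilpotent extension of `R`. -/

namespace NTrivialExt

variable {n : ℕ} {R : Type u} [Ring R] {M : Finset.Icc 1 n → Type u}
  [∀ i, AddCommGroup (M i)] [∀ i, Module R (M i)] [∀ i, Module Rᵐᵒᵖ (M i)]
  [∀ i, SMulCommClass R Rᵐᵒᵖ (M i)] (Φ : PreProduct n R M)

/-- The projection of `R ⋉ₙ M` onto `R`. -/
def baseHom : NTrivialExt Φ →+* R where
  toFun := base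
  map_one' := rfl
  map_mul' := base_mul
  map_zero' := rfl
  map_add' := base_add

/-- The inclusion of `R` into `R ⋉ₙ M`. -/
def inclHom : R →+* NTrivialExt Φ where
  toFun r := mk r 0
  map_one' := rfl
  map_mul' r s := by ext <;> simp [comp_mul]
  map_zero' := rfl
  map_add' r s := by ext <;> simp

instance : RingHomCompTriple (inclHom Φ) (baseHom Φ) (RingHom.id R) := ⟨rfl⟩

/-- The kernel lives in degrees ≥ 1, so a product of j + 1 of its elements lives in degrees ≥ j + 1.
-/
theorem eq_zero_of_mem_ker_baseHom_pow (j : ℕ) (s : NTrivialExt Φ)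
    (hs : s ∈ RingHom.ker (baseHom Φ) ^ (j + 1)) :
    s.base = 0 ∧ ∀ i : Finset.Icc 1 n, (i : ℕ) ≤ j → s.comp i = 0 := by
  induction j generalizing s with
  | zero =>
    rw [zero_add, Submodule.pow_one] at hs
    exact ⟨hs, fun i hi => absurd (Finset.mem_Icc.1 i.2).1 (by omega)⟩
  | succ j ih =>
    rw [Submodule.pow_succ, ← Ideal.smul_eq_mul] at hs
    refine Submodule.smul_induction_on hs (fun s hs t ht => ?_) fun s t hs ht => ?_
    · have ht : t.base = 0 := ht
      obtain ⟨hs₀, hs⟩ := ih s hs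
      refine ⟨by simp [hs₀], fun k hk => ?_⟩
      rw [smul_eq_mul, comp_mul, hs₀, ht, Finset.sum_eq_zero]
      · simp
      · refine fun a _ => Finset.sum_eq_zero fun b _ => ?_
        by_cases h : (a : ℕ) + b = k
        · have := (Finset.mem_Icc.1 b.2).1
          rw [hs a (by omega), map_zero, AddMonoidHom.zero_apply]
        · simp [mulAt, dif_neg h]
    · exact ⟨by simp [hs.1, ht.1], fun i hi => by simp [hs.2 i hi, ht.2 i hi]⟩

theorem ker_baseHom_pow : RingHom.ker (baseHom Φ) ^ (n + 1) = ⊥ := by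
  refine eq_bot_iff.2 fun s hs => ?_
  obtain ⟨h₀, h⟩ := eq_zero_of_mem_ker_baseHom_pow Φ n s hs
  exact NTrivialExt.ext h₀ fun i => h i (Finset.mem_Icc.1 i.2).2

end NTrivialExt

theorem theorem4 (k n : ℕ) (R : Type u) [Ring R] (M : Finset.Icc 1 n → Type u)
    [∀ i, AddCommGroup (M i)] [∀ i, Module R (M i)] [∀ i, Module Rᵐᵒᵖ (M i)]
    [∀ i, SMulCommClass R Rᵐᵒᵖ (M i)] (Φ : PreProduct n R M) :
    IsKPerfect (NTrivialExt Φ) k ↔ IsKPerfect R k :=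
  isKPerfect_iff_of_nilpotent_ker (σ := NTrivialExt.inclHom Φ) (NTrivialExt.ker_baseHom_pow Φ) k
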